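/- Let $r,k\ge 0$ be integers and let $\mathcal F=(F_1,\dots,F_k)$ be a family of (not necessarily distinct) subsets of $[r]=\{1,\dots,r\}$. For $F\subseteq[r]$ let $\Delta_F=\{x\in\mathbb R^r : x_i\ge 0 \text{ for all } i,\ \sum_i x_i=1,\ x_i=0\text{ for } i\notin F\}$, and let $P_{\mathcal F}=\Delta_{F_1}+\cdots+\Delta_{F_k}\subseteq\mathbb R^r$ be the Minkowski sum. For $i\in[r]$ put $N_{\mathcal F}(i)=\{j\in[k] : i\in F_j\}$. A face of a polytope is the set of points at which some linear function attains its maximum over the polytope; vertices and edges are the faces of dimension $0$ and $1$. Fix an enumeration $S_1,\dots,S_{2^k-1}$ of the nonempty subsets of $[k]$ (for instance the lexicographic one). Let $\mathcal H(k)=(H_1,\dots,H_k)$ be the family of subsets of $[2^k-1]$ with $N_{\mathcal H(k)}(i)=S_i$ for all $i$, that is, $H_j=\{i : j\in S_i\}$. The polytope $P(k)=P_{\mathcal H(k)}\subseteq\mathbb R^{2^k-1}$ is called the $k$-th master polytope. For $u\in P_{\mathcal F}$ let $h_{\mathcal F}(u)\in\mathbb R^{2^k-1}$ be the point whose $i$-th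 coordinate is $\sum_{j\,:\,N_{\mathcal F}(j)=S_i}u_j$ (an empty sum being $0$). If $A$ is a vertex of $P(k)$, a vertex $u$ of $P_{\mathcal F}$ is said to be of type $A$ if $h_{\mathcal F}(u)=A$. **Theorem.** Every edge of $P_{\mathcal F}$ is a segment $[u,w]$ with two distinct endpoints $u,w$ that are vertices of $P_{\mathcal F}$, and one of the following holds: 1. (internal edge) $u$ and $w$ are both of type $A$ for some vertex $A$ of $P(k)$; 2. $u$ is of type $A$ and $w$ is of type $B$ for some vertices $A,B$ of $P(k)$ such that the segment $[A,B]$ is an edge of $P(k)$. -/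

import Mathlib

namespace SimplexSum

/-- The face `Δ_F` of the standard simplex in `ℝ^r`. -/
def simplexFace {r : ℕ} (F : Finset (Fin r)) : Set (Fin r → ℝ) :=
  {x | x ∈ stdSimplex ℝ (Fin r) ∧ ∀ i, i ∉ F → x i = 0}

/-- The Minkowski sum `P_F` of the simplices of the family `F = (F_1, …, F_k)`. Members of the
family may be repeated. -/
def minkowskiSum {r k : ℕ} (F : Fin k → Finset (Fin r)) : Set (Fin r → ℝ) :=
  {x | ∃ y : Fin k → Fin r → ℝ, (∀ j, y j ∈ simplexFace (F j)) ∧ x = ∑ j, y j}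

/-- `N_F(i)`, the set of indices `j` with `i ∈ F_j`. -/
def incidence {r k : ℕ} (F : Fin k → Finset (Fin r)) (i : Fin r) : Finset (Fin k) :=
  {j | i ∈ F j}

/-- An enumeration of the `2^k - 1` nonempty subsets of `[k]`. -/
abbrev SubsetEnumeration (k : ℕ) : Type :=
  Fin (2 ^ k - 1) ≃ {S : Finset (Fin k) // S.Nonempty}

/-- The family `H(k)` of `k` subsets of `[2^k - 1]` for which `N_{H(k)}(i)` is the `i`-th nonempty
subset of `[k]` in the enumeration `σ`. -/
def masterFamily {k : ℕ} (σ : SubsetEnumeration k) : Fin k → Finset (Fin (2 ^ k - 1)) :=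
  fun j => {i | j ∈ (σ i).1}

theorem incidence_masterFamily {k : ℕ} (σ : SubsetEnumeration k) (i : Fin (2 ^ k - 1)) :
    incidence (masterFamily σ) i = (σ i).1 := by
  ext j
  simp [incidence, masterFamily]

/-- The master polytope `P(k)`. -/
def masterPolytope {k : ℕ} (σ : SubsetEnumeration k) : Set (Fin (2 ^ k - 1) → ℝ) :=
  minkowskiSum (masterFamily σ)

/-- The map `h_F`: the `i`-th coordinate of `h_F(u)` is the sum of the `u_j` over all `j` with
`N_F(j) = N_{H(k)}(i)` (which is `0` if there is no such `j`). -/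
def typeMap {r k : ℕ} (σ : SubsetEnumeration k) (F : Fin k → Finset (Fin r))
    (u : Fin r → ℝ) : Fin (2 ^ k - 1) → ℝ :=
  fun i => ∑ j with incidence F j = incidence (masterFamily σ) i, u j

/-- `v` is a vertex of `P`: the only maximizer over `P` of some linear function. -/
def IsVertex {n : ℕ} (P : Set (Fin n → ℝ)) (v : Fin n → ℝ) : Prop :=
  v ∈ P.exposedPoints ℝ

/-- `E` is an edge of `P`: a one-dimensional set of the maximizers over `P` of some linear
function. -/
def IsEdge {n : ℕ} (P E : Set (Fin n → ℝ)) : Prop :=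
  IsExposed ℝ P E ∧ Module.finrank ℝ (vectorSpan ℝ E) = 1

/-- `u` is a vertex of `P_F` of type `A`, where `A` is a vertex of the master polytope. -/
def IsVertexOfType {r k : ℕ} (σ : SubsetEnumeration k) (F : Fin k → Finset (Fin r))
    (A : Fin (2 ^ k - 1) → ℝ) (u : Fin r → ℝ) : Prop :=
  IsVertex (minkowskiSum F) u ∧ IsVertex (masterPolytope σ) A ∧ typeMap σ F u = A

end SimplexSum

namespace SimplexSum

/-! The face of `P_F` in direction `c` is the sum of the simplices on the sets `argmaxOn c (F j)`
(`maximizers_minkowskiSum`). If it is one-dimensional, all differences `e_i - e_i'` within these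
sets are parallel, which forces every summand to be a point or one common segment `[e_a, e_b]`
(`exists_pair_of_finrank_eq_one`). The face is then a segment; breaking the ties of `c` towards `a`
or `b` exposes its ends.

To reach `P(k)`, give each nonempty `S ⊆ [k]` the maximum of `c` over the indices with incidence set
`S` (`exists_transfer`). The maximizers on `H_j` are then the types of those on `F_j`, so the
corresponding face of `P(k)` is again a sum of points and copies of one segment. It is a point if
`a` and `b` have the same type (internal edge), and otherwise the edge `[A, B]`. -/

/-! ### Faces of a sum of simplices -/

/-- The subset of `F` on which `c` attains its maximum over `F`. -/
noncomputable def argmaxOn {n : ℕ} (c : Fin n → ℝ) (F : Finset (Fin n)) : Finset (Fin n) :=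
  {i ∈ F | ∀ i' ∈ F, c i' ≤ c i}

theorem mem_argmaxOn {n : ℕ} {c : Fin n → ℝ} {F : Finset (Fin n)} {i : Fin n} :
    i ∈ argmaxOn c F ↔ i ∈ F ∧ ∀ i' ∈ F, c i' ≤ c i := by
  simp [argmaxOn]

theorem argmaxOn_nonempty {n : ℕ} (c : Fin n → ℝ) {F : Finset (Fin n)} (hF : F.Nonempty) :
    (argmaxOn c F).Nonempty := by
  obtain ⟨i, hi, h⟩ := F.exists_max_image c hF
  exact ⟨i, mem_argmaxOn.2 ⟨hi, h⟩⟩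

/-- The linear functional with coefficients `c`. -/
def functional {n : ℕ} (c : Fin n → ℝ) : StrongDual ℝ (Fin n → ℝ) :=
  ∑ i, c i • ContinuousLinearMap.proj i

theorem functional_apply {n : ℕ} (c x : Fin n → ℝ) : functional c x = ∑ i, c i * x i := by
  simp [functional]

theorem eq_functional {n : ℕ} (l : StrongDual ℝ (Fin n → ℝ)) :
    l = functional fun i => l (Pi.single i 1) := by
  ext x
  rw [functional_apply, ← ContinuousLinearMap.coe_coe, LinearMap.pi_apply_eq_sum_univ]
  refine Finset.sum_congr rfl fun i _ => ?_
  rw [smul_eq_mul, mul_comm]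
  congr 2
  ext j
  simp [Pi.single_apply, eq_comm]

theorem single_mem_simplexFace {n : ℕ} {F : Finset (Fin n)} {i : Fin n} (hi : i ∈ F) :
    (Pi.single i 1 : Fin n → ℝ) ∈ simplexFace F := by
  refine ⟨single_mem_stdSimplex ℝ i, fun i' hi' => ?_⟩
  rw [Pi.single_eq_of_ne]
  rintro rfl
  exact hi' hi

theorem simplexFace_mono {n : ℕ} {F G : Finset (Fin n)} (h : F ⊆ G) :
    simplexFace F ⊆ simplexFace G :=
  fun _ hx => ⟨hx.1, fun i hi => hx.2 i fun hi' => hi (h hi')⟩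

theorem nonempty_of_mem_simplexFace {n : ℕ} {F : Finset (Fin n)} {x : Fin n → ℝ}
    (hx : x ∈ simplexFace F) : F.Nonempty := by
  by_contra h
  rw [Finset.not_nonempty_iff_eq_empty] at h
  subst h
  have h1 := hx.1.2
  rw [Finset.sum_eq_zero fun i _ => hx.2 i (by simp)] at h1
  norm_num at h1

theorem convex_simplexFace {n : ℕ} (F : Finset (Fin n)) : Convex ℝ (simplexFace F) := by
  intro x hx y hy s t hs ht hst
  refine ⟨convex_stdSimplex ℝ _ hx.1 hy.1 hs ht hst, fun i hi => ?_⟩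
  simp [hx.2 i hi, hy.2 i hi]

theorem convex_minkowskiSum {n k : ℕ} (F : Fin k → Finset (Fin n)) :
    Convex ℝ (minkowskiSum F) := by
  rintro _ ⟨y, hy, rfl⟩ _ ⟨z, hz, rfl⟩ s t hs ht hst
  refine ⟨fun j => s • y j + t • z j,
    fun j => convex_simplexFace _ (hy j) (hz j) hs ht hst, ?_⟩
  rw [Finset.sum_add_distrib, Finset.smul_sum, Finset.smul_sum]

theorem functional_le_of_mem_simplexFace {n : ℕ} {c : Fin n → ℝ} {F : Finset (Fin n)}
    {g : Fin n} (hg : g ∈ argmaxOn c F) {x : Fin n → ℝ} (hx : x ∈ simplexFace F) :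
    functional c x ≤ c g := by
  have h : ∑ i, c g * x i = c g := by rw [← Finset.mul_sum, hx.1.2, mul_one]
  rw [functional_apply, ← h]
  refine Finset.sum_le_sum fun i _ => ?_
  by_cases hi : i ∈ F
  · exact mul_le_mul_of_nonneg_right ((mem_argmaxOn.1 hg).2 i hi) (hx.1.1 i)
  · simp [hx.2 i hi]

/-- A weighted average of the `c i` equals their maximum only if smaller values carry no weight. -/
theorem functional_eq_iff_mem_simplexFace_argmaxOn {n : ℕ} {c : Fin n → ℝ} {F : Finset (Fin n)}
    {g : Fin n} (hg : g ∈ argmaxOn c F) {x : Fin n → ℝ} (hx : x ∈ simplexFace F) :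
    functional c x = c g ↔ x ∈ simplexFace (argmaxOn c F) := by
  have h : ∑ i, c g * x i = c g := by rw [← Finset.mul_sum, hx.1.2, mul_one]
  have hle : ∀ i ∈ Finset.univ, c i * x i ≤ c g * x i := fun i _ => by
    by_cases hi : i ∈ F
    · exact mul_le_mul_of_nonneg_right ((mem_argmaxOn.1 hg).2 i hi) (hx.1.1 i)
    · simp [hx.2 i hi]
  rw [functional_apply]
  rw [← h]
  rw [Finset.sum_eq_sum_iff_of_le hle]
  constructor
  · refine fun hc => ⟨hx.1, fun i hi => ?_⟩
    by_contra h0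
    have hiF : i ∈ F := by
      by_contra hiF
      exact h0 (hx.2 i hiF)
    have hci : c i = c g := mul_right_cancel₀ h0 (hc i (Finset.mem_univ i))
    exact hi (mem_argmaxOn.2 ⟨hiF, hci ▸ (mem_argmaxOn.1 hg).2⟩)
  · intro hx' i _
    by_cases hi : i ∈ argmaxOn c F
    · rw [le_antisymm ((mem_argmaxOn.1 hg).2 i (mem_argmaxOn.1 hi).1)
        ((mem_argmaxOn.1 hi).2 g (mem_argmaxOn.1 hg).1)]
    · simp [hx'.2 i hi]

/-- The face of a Minkowski sum of simplices in a given direction is the Minkowski sum of the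
faces of the summands. -/
theorem maximizers_minkowskiSum {n k : ℕ} (F : Fin k → Finset (Fin n)) (c : Fin n → ℝ)
    (hF : ∀ j, (F j).Nonempty) :
    {x ∈ minkowskiSum F | ∀ y ∈ minkowskiSum F, functional c y ≤ functional c x} =
      minkowskiSum fun j => argmaxOn c (F j) := by
  choose g hg using fun j => argmaxOn_nonempty c (hF j)
  have hgF : ∀ j, g j ∈ F j := fun j => (mem_argmaxOn.1 (hg j)).1
  have hv : ∀ i, functional c (Pi.single i 1) = c i := fun i => by
    simp [functional_apply, Pi.single_apply]
  ext x
  constructor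
  · rintro ⟨⟨y, hy, rfl⟩, hmax⟩
    refine ⟨y, fun j => ?_, rfl⟩
    -- The competitor `∑ j, e_{g j}` attains every summand's bound, so those bounds are all
    -- equalities.
    have h := hmax _ ⟨fun j => Pi.single (g j) 1, fun j => single_mem_simplexFace (hgF j), rfl⟩
    simp only [map_sum, hv] at h
    have hle : ∀ j ∈ Finset.univ, functional c (y j) ≤ c (g j) :=
      fun j _ => functional_le_of_mem_simplexFace (hg j) (hy j)
    have heq := (Finset.sum_eq_sum_iff_of_le hle).1 (le_antisymm (Finset.sum_le_sum hle) h)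
    exact (functional_eq_iff_mem_simplexFace_argmaxOn (hg j) (hy j)).1
      (heq j (Finset.mem_univ j))
  · rintro ⟨y, hy, rfl⟩
    have hyF : ∀ j, y j ∈ simplexFace (F j) :=
      fun j => simplexFace_mono (Finset.filter_subset _ _) (hy j)
    refine ⟨⟨y, hyF, rfl⟩, ?_⟩
    rintro _ ⟨z, hz, rfl⟩
    simp only [map_sum]
    refine Finset.sum_le_sum fun j _ => ?_
    rw [(functional_eq_iff_mem_simplexFace_argmaxOn (hg j) (hyF j)).2 (hy j)]
    exact functional_le_of_mem_simplexFace (hg j) (hz j)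

/-! ### Sums of points and parallel segments -/

/-- The point `∑ j, e_{g j}`. -/
def sumSingle {n k : ℕ} (g : Fin k → Fin n) : Fin n → ℝ := ∑ j, Pi.single (g j) 1

theorem mem_simplexFace_pair {n : ℕ} {a b : Fin n} {x : Fin n → ℝ}
    (hx : x ∈ simplexFace {a, b}) :
    ∃ s : ℝ, 0 ≤ s ∧ s ≤ 1 ∧
      x = Pi.single b 1 + s • (Pi.single a 1 - Pi.single b 1 : Fin n → ℝ) := by
  have h1 := hx.1.2
  have h0 : ∀ i, i ≠ a → i ≠ b → x i = 0 := fun i ha hb => hx.2 i (by simp [ha, hb])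
  by_cases hab : a = b
  · subst hab
    rw [Fintype.sum_eq_single a fun i hi => h0 i hi hi] at h1
    refine ⟨0, le_rfl, zero_le_one, ?_⟩
    ext i
    by_cases hi : i = a
    · subst hi; simp [h1]
    · simp [hi, h0 i hi hi]
  · rw [Fintype.sum_eq_add a b hab fun i hi => h0 i hi.1 hi.2] at h1
    have ha := hx.1.1 a
    have hb := hx.1.1 b
    refine ⟨x a, ha, by linarith, ?_⟩
    ext i
    by_cases hi : i = a
    · subst hi; simp [hab]
    · by_cases hi' : i = b
      · subst hi'
        simp [hi]
        linarith
      · simp [hi, hi', h0 i hi hi']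

theorem sumSingle_mem_minkowskiSum {n k : ℕ} {F : Fin k → Finset (Fin n)} {g : Fin k → Fin n}
    (hg : ∀ j, g j ∈ F j) : sumSingle g ∈ minkowskiSum F :=
  ⟨_, fun j => single_mem_simplexFace (hg j), rfl⟩

/-- If the selections `g` and `g'` differ only in that `g` picks `a` where `g'` picks `b`, then the
sum of the segments `[e_{g j}, e_{g' j}]` is the segment between the two sums. -/
theorem minkowskiSum_pair {n k : ℕ} {g g' : Fin k → Fin n} {a b : Fin n}
    (h : ∀ j, g j = g' j ∨ g j = a ∧ g' j = b) :
    minkowskiSum (fun j => {g j, g' j}) = segment ℝ (sumSingle g) (sumSingle g') := by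
  apply Set.Subset.antisymm
  · rintro _ ⟨y, hy, rfl⟩
    choose s hs0 hs1 hs using fun j => mem_simplexFace_pair (hy j)
    -- `χ j` is `0` for a point and `1` for a copy of the segment.
    have hχ : ∀ j, ∃ χ : ℝ, 0 ≤ χ ∧ (Pi.single (g j) 1 - Pi.single (g' j) 1 : Fin n → ℝ) =
        χ • (Pi.single a 1 - Pi.single b 1 : Fin n → ℝ) := fun j => by
      rcases h j with h | ⟨ha, hb⟩
      · exact ⟨0, le_rfl, by simp [h]⟩
      · exact ⟨1, zero_le_one, by simp [ha, hb]⟩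
    choose χ hχ0 hχ using hχ
    set D : Fin n → ℝ := Pi.single a 1 - Pi.single b 1
    have hx : ∑ j, y j = sumSingle g' + (∑ j, s j * χ j) • D := by
      rw [sumSingle, Finset.sum_smul, ← Finset.sum_add_distrib]
      refine Finset.sum_congr rfl fun j _ => ?_
      rw [hs j, hχ j, smul_smul]
    have hd : sumSingle g - sumSingle g' = (∑ j, χ j) • D := by
      rw [sumSingle, sumSingle, ← Finset.sum_sub_distrib, Finset.sum_smul]
      exact Finset.sum_congr rfl fun j _ => hχ j
    have hm : 0 ≤ ∑ j, χ j := Finset.sum_nonneg fun j _ => hχ0 j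
    have hθ0 : 0 ≤ ∑ j, s j * χ j := Finset.sum_nonneg fun j _ => mul_nonneg (hs0 j) (hχ0 j)
    have hθ1 : ∑ j, s j * χ j ≤ ∑ j, χ j :=
      Finset.sum_le_sum fun j _ => mul_le_of_le_one_left (hχ0 j) (hs1 j)
    rw [segment_symm, segment_eq_image']
    -- If `∑ χ j = 0`, the quotient is `0` by convention, and `hθ0`, `hθ1` make the numerator vanish
    -- too.
    refine ⟨(∑ j, s j * χ j) / ∑ j, χ j, ⟨div_nonneg hθ0 hm, div_le_one_of_le₀ hθ1 hm⟩, ?_⟩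
    simp only [hd, hx, smul_smul]
    congr 2
    rcases hm.eq_or_lt with hm | hm
    · rw [← hm, mul_zero]
      linarith
    · exact div_mul_cancel₀ _ hm.ne'
  · exact (convex_minkowskiSum _).segment_subset (sumSingle_mem_minkowskiSum (by simp))
      (sumSingle_mem_minkowskiSum (by simp))

/-- The coordinate at `a` separates the two sums. -/
theorem sumSingle_ne {n k : ℕ} {g g' : Fin k → Fin n} {a b : Fin n} (hab : a ≠ b)
    (h : ∀ j, g j = g' j ∨ g j = a ∧ g' j = b) {j₀ : Fin k} (hj₀ : g j₀ ≠ g' j₀) :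
    sumSingle g ≠ sumSingle g' := by
  intro heq
  have ha := congrFun heq a
  simp only [sumSingle, Finset.sum_apply] at ha
  refine absurd ha (ne_of_gt (Finset.sum_lt_sum (fun j _ => ?_) ⟨j₀, Finset.mem_univ _, ?_⟩))
  · rcases h j with h | ⟨h, h'⟩
    · rw [h]
    · simp [h, h', hab]
  · rcases h j₀ with h | ⟨h, h'⟩
    · exact absurd h hj₀
    · simp [h, h', hab]

theorem minkowskiSum_singleton {n k : ℕ} (g : Fin k → Fin n) :
    minkowskiSum (fun j => {g j}) = {sumSingle g} := by
  refine Set.Subset.antisymm ?_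
    (Set.singleton_subset_iff.2 (sumSingle_mem_minkowskiSum fun j => by simp))
  rintro _ ⟨y, hy, rfl⟩
  refine Finset.sum_congr rfl fun j _ => ?_
  obtain ⟨s, -, -, hs⟩ := mem_simplexFace_pair (a := g j) (b := g j) (by simpa using hy j)
  simpa using hs

theorem isVertex_sumSingle {n k : ℕ} {F : Fin k → Finset (Fin n)} {c : Fin n → ℝ}
    {g : Fin k → Fin n} (h : ∀ j, argmaxOn c (F j) = {g j}) :
    IsVertex (minkowskiSum F) (sumSingle g) := by
  have hg : ∀ j, g j ∈ argmaxOn c (F j) := fun j => by simp [h j]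
  have hmax := maximizers_minkowskiSum F c fun j => ⟨g j, (mem_argmaxOn.1 (hg j)).1⟩
  have hsingle : (minkowskiSum fun j => argmaxOn c (F j)) = {sumSingle g} := by
    rw [funext h, minkowskiSum_singleton]
  rw [hsingle] at hmax
  have hmem : sumSingle g ∈ {x ∈ minkowskiSum F |
      ∀ y ∈ minkowskiSum F, functional c y ≤ functional c x} := by simp [hmax]
  refine ⟨hmem.1, functional c, fun y hy => ⟨hmem.2 y hy, fun hle => ?_⟩⟩
  have : y ∈ {x ∈ minkowskiSum F | ∀ y ∈ minkowskiSum F, functional c y ≤ functional c x} :=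
    ⟨hy, fun z hz => (hmem.2 z hz).trans hle⟩
  rwa [hmax] at this

/-! ### Perturbation to a vertex -/

/-- A functional refining `c` that breaks ties according to `d`. -/
theorem exists_refinement {n : ℕ} (c d : Fin n → ℝ) :
    ∃ c' : Fin n → ℝ, (∀ i i', c i < c i' → c' i < c' i') ∧
      ∀ i i', c i = c i' → d i < d i' → c' i < c' i' := by
  -- Take `c + ε d`: the finitely many strict inequalities of `c` survive for small `ε > 0`.
  have h : ∀ᶠ ε : ℝ in nhdsWithin 0 (Set.Ioi 0),
      ∀ i i', c i < c i' → c i + ε * d i < c i' + ε * d i' := by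
    refine Filter.eventually_all.2 fun i => Filter.eventually_all.2 fun i' => ?_
    by_cases hi : c i < c i'
    · refine Filter.Eventually.filter_mono nhdsWithin_le_nhds ?_
      have h1 : Filter.Tendsto (fun ε : ℝ => c i + ε * d i) (nhds 0) (nhds (c i)) := by
        have : Continuous fun ε : ℝ => c i + ε * d i := by fun_prop
        simpa using this.tendsto 0
      have h2 : Filter.Tendsto (fun ε : ℝ => c i' + ε * d i') (nhds 0) (nhds (c i')) := by
        have : Continuous fun ε : ℝ => c i' + ε * d i' := by fun_prop
        simpa using this.tendsto 0
      filter_upwards [h1.eventually_lt h2 hi] with ε hε _ using hε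
    · exact Filter.Eventually.of_forall fun ε h' => absurd h' hi
  obtain ⟨ε, hε, hε0⟩ := (h.and self_mem_nhdsWithin).exists
  refine ⟨fun i => c i + ε * d i, hε, fun i i' hc hd => ?_⟩
  have := mul_lt_mul_of_pos_left hd (Set.mem_Ioi.1 hε0)
  simp only [hc]
  linarith

theorem exists_argmaxOn_eq_singleton {n k : ℕ} {F : Fin k → Finset (Fin n)} {c : Fin n → ℝ}
    {g g' : Fin k → Fin n} (hG : ∀ j, argmaxOn c (F j) = {g j, g' j}) (d : Fin n → ℝ)
    (hd : ∀ j, g j = g' j ∨ d (g' j) < d (g j)) :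
    ∃ c' : Fin n → ℝ, ∀ j, argmaxOn c' (F j) = {g j} := by
  obtain ⟨c', h1, h2⟩ := exists_refinement c d
  refine ⟨c', fun j => ?_⟩
  have hg : g j ∈ argmaxOn c (F j) := by simp [hG j]
  have hlt : ∀ i ∈ F j, i ≠ g j → c' i < c' (g j) := by
    intro i hi hne
    rcases ((mem_argmaxOn.1 hg).2 i hi).lt_or_eq with hc | hc
    · exact h1 _ _ hc
    · have him : i ∈ argmaxOn c (F j) := mem_argmaxOn.2 ⟨hi, hc ▸ (mem_argmaxOn.1 hg).2⟩
      rw [hG j] at him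
      have hi' : i = g' j := by simpa [hne] using him
      subst hi'
      exact h2 _ _ hc ((hd j).resolve_left (Ne.symm hne))
  ext i
  rw [mem_argmaxOn, Finset.mem_singleton]
  constructor
  · rintro ⟨hi, hmax⟩
    by_contra hne
    exact absurd (hmax _ (mem_argmaxOn.1 hg).1) (not_le.2 (hlt i hi hne))
  · rintro rfl
    refine ⟨(mem_argmaxOn.1 hg).1, fun i hi => ?_⟩
    by_cases hne : i = g j
    · rw [hne]
    · exact (hlt i hi hne).le

/-! ### One-dimensional sums -/

theorem finrank_vectorSpan_segment {n : ℕ} {u w : Fin n → ℝ} (h : u ≠ w) :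
    Module.finrank ℝ (vectorSpan ℝ (segment ℝ u w)) = 1 := by
  rw [← convexHull_pair, ← direction_affineSpan, affineSpan_convexHull, direction_affineSpan,
    vectorSpan_pair_rev]
  exact finrank_span_singleton (by simpa [sub_eq_zero] using h.symm)

/-- Two selections that differ only at `j` give points of the sum with this difference. -/
theorem single_sub_single_mem_vectorSpan {n k : ℕ} {G : Fin k → Finset (Fin n)}
    (hG : ∀ j, (G j).Nonempty) {j : Fin k} {i i' : Fin n} (hi : i ∈ G j) (hi' : i' ∈ G j) :
    (Pi.single i 1 - Pi.single i' 1 : Fin n → ℝ) ∈ vectorSpan ℝ (minkowskiSum G) := by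
  choose g hg using hG
  have hmem : ∀ t ∈ G j, sumSingle (Function.update g j t) ∈ minkowskiSum G := fun t ht =>
    sumSingle_mem_minkowskiSum fun l => by
      by_cases hl : l = j
      · subst hl; simpa using ht
      · simpa [hl] using hg l
  have h := vsub_mem_vectorSpan ℝ (hmem i hi) (hmem i' hi')
  convert h using 1
  rw [vsub_eq_sub, sumSingle, sumSingle, ← Finset.sum_sub_distrib, Finset.sum_eq_single j]
  · simp
  · intro l _ hl
    simp [hl]
  · simp

/-- The left side is nonzero at `i` and `i'`, so both lie in `{a, b}`. -/
theorem pair_eq_of_single_sub_eq_smul {n : ℕ} {a b i i' : Fin n} (hii' : i ≠ i') {t : ℝ}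
    (h : (Pi.single i 1 - Pi.single i' 1 : Fin n → ℝ) =
      t • (Pi.single a 1 - Pi.single b 1 : Fin n → ℝ)) :
    i = a ∧ i' = b ∨ i = b ∧ i' = a := by
  have h1 := congrFun h i
  have h2 := congrFun h i'
  simp only [Pi.sub_apply, Pi.smul_apply, Pi.single_apply, smul_eq_mul, if_neg hii',
    if_neg hii'.symm, if_true] at h1 h2
  grind

/-- A one-dimensional sum of simplices is a sum of points and of segments with the same two
endpoints. -/
theorem exists_pair_of_finrank_eq_one {n k : ℕ} {G : Fin k → Finset (Fin n)}
    (hG : ∀ j, (G j).Nonempty)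
    (h1 : Module.finrank ℝ (vectorSpan ℝ (minkowskiSum G)) = 1) :
    ∃ (g g' : Fin k → Fin n) (a b : Fin n), a ≠ b ∧ (∀ j, G j = {g j, g' j}) ∧
      (∀ j, g j = g' j ∨ g j = a ∧ g' j = b) ∧ ∃ j, g j = a ∧ g' j = b := by
  have hex : ∃ j₀, ∃ a ∈ G j₀, ∃ b ∈ G j₀, a ≠ b := by
    by_contra! hcon
    choose g hg using hG
    have hGg : G = fun j => {g j} := by
      ext j i
      simp only [Finset.mem_singleton]
      exact ⟨fun hi => hcon j i hi _ (hg j), fun hi => hi ▸ hg j⟩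
    rw [hGg, minkowskiSum_singleton, vectorSpan_singleton, finrank_bot] at h1
    exact zero_ne_one h1
  obtain ⟨j₀, a, ha, b, hb, hab⟩ := hex
  have hD : (Pi.single a 1 - Pi.single b 1 : Fin n → ℝ) ≠ 0 := by
    intro h
    have := congrFun h a
    simp [hab] at this
  have hpair : ∀ j, ∀ i ∈ G j, ∀ i' ∈ G j, i ≠ i' → i = a ∧ i' = b ∨ i = b ∧ i' = a := by
    intro j i hi i' hi' hne
    obtain ⟨t, ht⟩ := exists_smul_eq_of_finrank_eq_one h1
      (x := ⟨_, single_sub_single_mem_vectorSpan hG ha hb⟩)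
      (fun h => hD (congrArg Subtype.val h)) ⟨_, single_sub_single_mem_vectorSpan hG hi hi'⟩
    exact pair_eq_of_single_sub_eq_smul hne (congrArg Subtype.val ht).symm
  -- The negated clause excludes the first alternative at `j₀`.
  have hsel : ∀ j, ∃ p : Fin n × Fin n, G j = {p.1, p.2} ∧
      (p.1 = p.2 ∧ ¬ (a ∈ G j ∧ b ∈ G j) ∨ p.1 = a ∧ p.2 = b) := by
    intro j
    by_cases hj : a ∈ G j ∧ b ∈ G j
    · refine ⟨(a, b), ?_, Or.inr ⟨rfl, rfl⟩⟩
      ext i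
      have := hpair j i
      grind
    · obtain ⟨i, hi⟩ := hG j
      refine ⟨(i, i), ?_, Or.inl ⟨rfl, hj⟩⟩
      ext i'
      have := hpair j i hi i'
      grind
  choose p hp hp' using hsel
  refine ⟨fun j => (p j).1, fun j => (p j).2, a, b, hab, hp,
    fun j => (hp' j).imp_left And.left, j₀, (hp' j₀).resolve_left fun h => h.2 ⟨ha, hb⟩⟩

/-! ### Comparison with the master polytope -/

/-- Every functional on `ℝ^r` has a companion on the space of the master polytope that attains its
maxima at the types of the original maximizers. -/
theorem exists_transfer {r k : ℕ} (σ : SubsetEnumeration k) (F : Fin k → Finset (Fin r))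
    (hF : ∀ j, (F j).Nonempty) (c : Fin r → ℝ) :
    ∃ c' : Fin (2 ^ k - 1) → ℝ, ∀ j t, t ∈ argmaxOn c' (masterFamily σ j) ↔
      ∃ i ∈ argmaxOn c (F j), incidence F i = (σ t).1 := by
  -- A type that does not occur gets a value below every `c i`, so it is never a maximizer.
  have hex : ∀ t, ∃ m : ℝ, (∀ i, incidence F i = (σ t).1 → c i ≤ m) ∧
      ((∃ i, incidence F i = (σ t).1 ∧ c i = m) ∨ ∀ i, m < c i) := by
    intro t
    by_cases ht : ({i | incidence F i = (σ t).1} : Finset (Fin r)).Nonempty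
    · obtain ⟨i, hi, hmax⟩ := Finset.exists_max_image _ c ht
      exact ⟨c i, fun i' hi' => hmax i' (by simpa using hi'),
        Or.inl ⟨i, by simpa using hi, rfl⟩⟩
    · refine ⟨-(1 + ∑ i, |c i|), fun i hi => absurd ⟨i, by simpa using hi⟩ ht,
        Or.inr fun i => ?_⟩
      have h1 := Finset.single_le_sum (f := fun i => |c i|) (fun i _ => abs_nonneg _)
        (Finset.mem_univ i)
      have h2 := neg_abs_le (c i)
      linarith
  choose c' hle hc' using hex
  have hH : ∀ j t, t ∈ masterFamily σ j ↔ j ∈ (σ t).1 := by simp [masterFamily]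
  have hN : ∀ {i t j}, incidence F i = (σ t).1 → (i ∈ F j ↔ j ∈ (σ t).1) := fun {i t j} h => by
    rw [← h]; simp [incidence]
  have htype : ∀ j, ∀ i ∈ F j, ∃ t, incidence F i = (σ t).1 := fun j i hi =>
    ⟨σ.symm ⟨incidence F i, j, by simpa [incidence] using hi⟩, by simp⟩
  refine ⟨c', fun j t => ?_⟩
  obtain ⟨g, hg⟩ := argmaxOn_nonempty c (hF j)
  obtain ⟨hgF, hgmax⟩ := mem_argmaxOn.1 hg
  obtain ⟨s, hs⟩ := htype j g hgF
  have hub : ∀ t ∈ masterFamily σ j, c' t ≤ c g := fun t ht => by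
    rcases hc' t with ⟨i, hi, h⟩ | h
    · exact h ▸ hgmax i ((hN hi).2 ((hH j t).1 ht))
    · exact (h g).le
  rw [mem_argmaxOn]
  constructor
  · rintro ⟨ht, hmax⟩
    have hge : c g ≤ c' t := (hle s g hs).trans (hmax s ((hH j s).2 ((hN hs).1 hgF)))
    rcases hc' t with ⟨i, hi, h⟩ | h
    · exact ⟨i, mem_argmaxOn.2 ⟨(hN hi).2 ((hH j t).1 ht),
        fun i' hi' => (hgmax i' hi').trans (h ▸ hge)⟩, hi⟩
    · exact absurd hge (not_le.2 (h g))
  · rintro ⟨i, hi, hit⟩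
    obtain ⟨hiF, himax⟩ := mem_argmaxOn.1 hi
    exact ⟨(hH j t).2 ((hN hit).1 hiF),
      fun t' ht' => (hub t' ht').trans ((himax g hgF).trans (hle t i hit))⟩

/-- `typeMap` is additive and sends `e_i` to `e_t`, where `t` indexes the incidence set of `i`. -/
theorem typeMap_sumSingle {r k : ℕ} (σ : SubsetEnumeration k) (F : Fin k → Finset (Fin r))
    {g : Fin k → Fin r} {τ : Fin k → Fin (2 ^ k - 1)}
    (hτ : ∀ j, incidence F (g j) = (σ (τ j)).1) :
    typeMap σ F (sumSingle g) = sumSingle τ := by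
  ext t
  simp only [typeMap, sumSingle, Finset.sum_apply, incidence_masterFamily]
  rw [Finset.sum_comm]
  refine Finset.sum_congr rfl fun j _ => ?_
  simp only [Pi.single_apply, Finset.sum_ite_eq', Finset.mem_filter, Finset.mem_univ, true_and,
    hτ j]
  refine if_congr ?_ rfl rfl
  rw [Subtype.val_inj, σ.injective.eq_iff, eq_comm]

theorem isVertexOfType_sumSingle {r k : ℕ} (σ : SubsetEnumeration k)
    {F : Fin k → Finset (Fin r)} {c : Fin r → ℝ} {g : Fin k → Fin r}
    {τ : Fin k → Fin (2 ^ k - 1)} (hg : ∀ j, argmaxOn c (F j) = {g j})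
    (hτ : ∀ j, incidence F (g j) = (σ (τ j)).1) :
    IsVertexOfType σ F (sumSingle τ) (sumSingle g) := by
  obtain ⟨c', hc'⟩ := exists_transfer σ F
    (fun j => ⟨g j, (mem_argmaxOn.1 (by simp [hg j] : g j ∈ argmaxOn c (F j))).1⟩) c
  refine ⟨isVertex_sumSingle hg, isVertex_sumSingle (c := c') fun j => ?_,
    typeMap_sumSingle σ F hτ⟩
  ext t
  simp only [hc', hg, Finset.mem_singleton, exists_eq_left, hτ, Subtype.val_inj,
    σ.injective.eq_iff]
  exact eq_comm

theorem isExposed_minkowskiSum_argmaxOn {n k : ℕ} (F : Fin k → Finset (Fin n))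
    (hF : ∀ j, (F j).Nonempty) (c : Fin n → ℝ) :
    IsExposed ℝ (minkowskiSum F) (minkowskiSum fun j => argmaxOn c (F j)) :=
  fun _ => ⟨functional c, (maximizers_minkowskiSum F c hF).symm⟩

end SimplexSum

/-! ### The main theorem -/

theorem mainTheorem10 (r k : ℕ) (F : Fin k → Finset (Fin r))
    (σ : SimplexSum.SubsetEnumeration k) (E : Set (Fin r → ℝ))
    (hE : SimplexSum.IsEdge (SimplexSum.minkowskiSum F) E) :
    ∃ u w : Fin r → ℝ, u ≠ w ∧ E = segment ℝ u w ∧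
      ((∃ A : Fin (2 ^ k - 1) → ℝ,
          SimplexSum.IsVertexOfType σ F A u ∧ SimplexSum.IsVertexOfType σ F A w) ∨
        (∃ A B : Fin (2 ^ k - 1) → ℝ,
          SimplexSum.IsVertexOfType σ F A u ∧ SimplexSum.IsVertexOfType σ F B w ∧
            SimplexSum.IsEdge (SimplexSum.masterPolytope σ) (segment ℝ A B))) := by
  obtain ⟨hexp, hrank⟩ := hE
  -- `IsExposed` holds vacuously for the empty set; the rank condition excludes it.
  have hne : E.Nonempty := by
    by_contra h
    rw [Set.not_nonempty_iff_eq_empty] at h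
    subst h
    rw [vectorSpan_empty, finrank_bot] at hrank
    exact zero_ne_one hrank
  obtain ⟨l, hl⟩ := hexp hne
  have hF : ∀ j, (F j).Nonempty := by
    obtain ⟨x, hx⟩ := hne
    rw [hl] at hx
    obtain ⟨y, hy, -⟩ := hx.1
    exact fun j => SimplexSum.nonempty_of_mem_simplexFace (hy j)
  obtain ⟨c, rfl⟩ : ∃ c, l = SimplexSum.functional c := ⟨_, SimplexSum.eq_functional l⟩
  rw [SimplexSum.maximizers_minkowskiSum F c hF] at hl
  subst hl
  obtain ⟨g, g', a, b, hab, hG, hgg', j₀, ha, hb⟩ :=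
    SimplexSum.exists_pair_of_finrank_eq_one
      (fun j => SimplexSum.argmaxOn_nonempty c (hF j)) hrank
  have hmem : ∀ j, g j ∈ F j ∧ g' j ∈ F j := fun j =>
    ⟨(SimplexSum.mem_argmaxOn.1 (by simp [hG j] : g j ∈ SimplexSum.argmaxOn c (F j))).1,
      (SimplexSum.mem_argmaxOn.1 (by simp [hG j] : g' j ∈ SimplexSum.argmaxOn c (F j))).1⟩
  have htype : ∀ i, (∃ j, i ∈ F j) → ∃ t, SimplexSum.incidence F i = (σ t).1 :=
    fun i ⟨j, hi⟩ => ⟨σ.symm ⟨SimplexSum.incidence F i, j, by simpa [SimplexSum.incidence] using hi⟩,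
      by simp⟩
  choose τ hτ using fun j => htype (g j) ⟨j, (hmem j).1⟩
  choose τ' hτ' using fun j => htype (g' j) ⟨j, (hmem j).2⟩
  obtain ⟨cu, hcu⟩ := SimplexSum.exists_argmaxOn_eq_singleton hG (Pi.single a 1) fun j =>
    (hgg' j).imp_right fun h => by simp [h, hab]
  obtain ⟨cw, hcw⟩ := SimplexSum.exists_argmaxOn_eq_singleton
    (fun j => (hG j).trans (Finset.pair_comm _ _)) (Pi.single b 1) fun j =>
    (hgg' j).imp Eq.symm fun h => by simp [h, hab.symm]
  have hu := SimplexSum.isVertexOfType_sumSingle σ hcu hτ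
  have hw := SimplexSum.isVertexOfType_sumSingle σ hcw hτ'
  refine ⟨_, _, SimplexSum.sumSingle_ne hab hgg' (j₀ := j₀) (by rw [ha, hb]; exact hab),
    (by rw [funext hG]; exact SimplexSum.minkowskiSum_pair hgg'), ?_⟩
  -- The types inherit the pattern of `hgg'`, with `τ j₀` and `τ' j₀` in place of `a` and `b`, so
  -- `minkowskiSum_pair` applies in `P(k)` as well.
  have hττ' : ∀ j, τ j = τ' j ∨ τ j = τ j₀ ∧ τ' j = τ' j₀ := by
    intro j
    rcases hgg' j with h | ⟨h, h'⟩
    · exact Or.inl (σ.injective (Subtype.ext (by rw [← hτ, ← hτ', h])))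
    · exact Or.inr ⟨σ.injective (Subtype.ext (by rw [← hτ, ← hτ, h, ha])),
        σ.injective (Subtype.ext (by rw [← hτ', ← hτ', h', hb]))⟩
  by_cases h₀ : τ j₀ = τ' j₀
  · have hEq : τ = τ' := funext fun j => (hττ' j).elim id fun h => h.1.trans (h₀.trans h.2.symm)
    subst hEq
    exact Or.inl ⟨_, hu, hw⟩
  · refine Or.inr ⟨_, _, hu, hw, ?_,
      SimplexSum.finrank_vectorSpan_segment (SimplexSum.sumSingle_ne h₀ hττ' h₀)⟩
    obtain ⟨c', hc'⟩ := SimplexSum.exists_transfer σ F hF c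
    have hG' : (fun j => SimplexSum.argmaxOn c' (SimplexSum.masterFamily σ j)) =
        fun j => {τ j, τ' j} := by
      ext j t
      simp [hc', hG, hτ, hτ', Subtype.val_inj, eq_comm]
    rw [← SimplexSum.minkowskiSum_pair hττ', ← hG']
    exact SimplexSum.isExposed_minkowskiSum_argmaxOn _
      (fun j => ⟨τ j, by
        simpa [SimplexSum.masterFamily, ← hτ, SimplexSum.incidence] using (hmem j).1⟩) c'
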